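/- Let $H$ be a nonzero finite-dimensional complex Hilbert space, and let $(\Lambda_t)_{t\ge 0}$ be a dynamical map on $B(H)$, i.e. every $\Lambda_t:B(H)\to B(H)$ is linear, completely positive and trace preserving, and $\Lambda_0=\mathrm{id}$. Assume that $t\mapsto\Lambda_t$ is differentiable on $[0,\infty)$ (one-sidedly at $0$) and that every $\Lambda_t$ is invertible as a linear map (the inverse need not be completely positive). For $t\ge s\ge 0$ let $V_{t,s}=\Lambda_t\Lambda_s^{-1}$ be the propagator, i.e. the unique linear map with $\Lambda_t=V_{t,s}\Lambda_s$. Let $\|W\|_1=\mathrm{Tr}\sqrt{W^\dagger W}$ be the trace norm and, for a linear map $\Phi$ on $B(H)$, let $\|\Phi\|_\diamond=\sup\{\|(\mathrm{id}\otimes\Phi)W\|_1 : W\in B(H\otimes H),\ \|W\|_1=1\}$. Then the following conditions are equivalent: 1. $\Lambda_t$ is divisible: for all $t\ge s\ge 0$ there is a completely positive linear map $V$ on $B(H)$ with $\Lambda_t=V\Lambda_s$; 2. $\|V_{t,s}\|_\diamond=1$ for all $t\ge s\ge 0$; 3. $\frac{d}{dt}\|(\mathrm{id}\otimes\Lambda_t)W\|_1\le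 0$ for all $t\ge 0$ and all Hermitian $W\in B(H\otimes H)$, where $\frac{d}{dt}$ denotes the right derivative (in particular, it exists). -/

import Mathlib

open scoped ComplexOrder MatrixOrder Matrix.Norms.L2Operator CStarAlgebra

namespace QuantumDynamics

/-- The trace norm `‖W‖₁ = Tr |W|`, where `|W| = √(W† W)`. -/
noncomputable def traceNorm {m : Type*} [Fintype m] [DecidableEq m] (W : Matrix m m ℂ) : ℝ :=
  (Matrix.trace (CFC.abs W)).re

/-- For a linear map `Φ` on `B(H)`, `H = ℂⁿ`, the map `id ⊗ Φ` on `B(ℂᵏ ⊗ H)`: it applies `Φ` to each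
of the blocks `(⟨i| ⊗ 1) W (|j⟩ ⊗ 1)` of `W`. -/
def idTensor {n : Type*} (k : Type*) (Φ : Module.End ℂ (Matrix n n ℂ)) :
    Module.End ℂ (Matrix (k × n) (k × n) ℂ) where
  toFun W := Matrix.of fun p q => Φ (Matrix.of fun a b => W (p.1, a) (q.1, b)) p.2 q.2
  map_add' X Y := by
    ext p q
    exact congrFun (congrFun (map_add Φ (Matrix.of fun a b => X (p.1, a) (q.1, b))
      (Matrix.of fun a b => Y (p.1, a) (q.1, b))) p.2) q.2
  map_smul' c X := by
    ext p q
    exact congrFun (congrFun (map_smul Φ c (Matrix.of fun a b => X (p.1, a) (q.1, b))) p.2) q.2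

variable {n : Type*} [Fintype n] [DecidableEq n]

/-- The diamond norm `‖Φ‖_⋄ = sup {‖(id ⊗ Φ) W‖₁ : ‖W‖₁ = 1}`, over all operators `W` on `H ⊗ H`. -/
noncomputable def diamondNorm (Φ : Module.End ℂ (Matrix n n ℂ)) : ℝ :=
  sSup {x : ℝ | ∃ W : Matrix (n × n) (n × n) ℂ,
    traceNorm W = 1 ∧ x = traceNorm (idTensor n Φ W)}

/-- Complete positivity of a linear map. -/
def IsCompletelyPositive (Φ : Module.End ℂ (Matrix n n ℂ)) : Prop :=
  ∃ Ψ : Matrix n n ℂ →CP Matrix n n ℂ, Ψ.toLinearMap = Φ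

/-- Dynamical maps: families of completely positive and trace preserving maps `Λ t`, `t ≥ 0`, with
`Λ 0 = id`. The values at negative times play no role. -/
structure IsDynamicalMap (Λ : ℝ → Module.End ℂ (Matrix n n ℂ)) : Prop where
  completelyPositive : ∀ t, 0 ≤ t → IsCompletelyPositive (Λ t)
  tracePreserving : ∀ t, 0 ≤ t → ∀ ρ, Matrix.trace (Λ t ρ) = Matrix.trace ρ
  map_zero_eq_id : Λ 0 = LinearMap.id

/-- `Λ` is divisible if for all `t ≥ s ≥ 0` one has `Λ t = V ∘ Λ s` with `V` completely positive. -/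
def IsDivisible (Λ : ℝ → Module.End ℂ (Matrix n n ℂ)) : Prop :=
  ∀ s t : ℝ, 0 ≤ s → s ≤ t →
    ∃ V : Module.End ℂ (Matrix n n ℂ), IsCompletelyPositive V ∧ Λ t = V ∘ₗ Λ s

/-- The propagator `V_{t,s} = Λ t ∘ (Λ s)⁻¹`, the only solution of `Λ t = V ∘ Λ s` when `Λ s` is
invertible (it is not used otherwise). -/
noncomputable def propagator (Λ : ℝ → Module.End ℂ (Matrix n n ℂ)) (t s : ℝ) :
    Module.End ℂ (Matrix n n ℂ) :=
  Λ t ∘ₗ Ring.inverse (Λ s)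

end QuantumDynamics

/-! Everything reduces to one test operator, `maxEntangled n`, whose image under id ⊗ V is the Choi
matrix of V. Propagators preserve trace and adjoints, so the Choi matrix of V_{t,s} is Hermitian,
with the same trace as `maxEntangled n`. If id ⊗ V_{t,s} does not increase the trace norm of
`maxEntangled n`, this matrix X has ‖X‖₁ ≤ Tr X, hence is positive, and Choi's criterion applies
(`isCompletelyPositive_of_traceNorm_le`). Both 2 and 3 supply that bound: 2 by scaling, 3 by
monotonicity along the orbit that passes through `maxEntangled n` at time s. Conversely, completely
positive trace preserving maps contract the trace norm
(`IsCompletelyPositive.traceNorm_idTensor_le`), which gives 2 and makes the norm in 3 nonincreasing.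
Its right derivative exists by convexity, although the norm is not smooth. -/

namespace QuantumDynamics

open Matrix

/-! ### Trace norm: polar decomposition and duality with contractions. -/

section TraceNorm

variable {m : Type*} [Fintype m]

lemma re_trace_nonneg {P : Matrix m m ℂ} (hP : P.PosSemidef) : 0 ≤ (trace P).re :=
  (Complex.le_def.mp hP.trace_nonneg).1

/-- Cauchy–Schwarz and AM–GM for the semi-inner product `Tr (X P Yᴴ)`. -/
lemma two_mul_re_trace_le {X Y P : Matrix m m ℂ} (hP : P.PosSemidef) :
    2 * (trace (X * P * Yᴴ)).re ≤ (trace (X * P * Xᴴ)).re + (trace (Y * P * Yᴴ)).re := by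
  have h := re_trace_nonneg (hP.mul_mul_conjTranspose_same (X - Y))
  have h1 : (trace (Y * P * Xᴴ)).re = (trace (X * P * Yᴴ)).re := by
    have : Y * P * Xᴴ = (X * P * Yᴴ)ᴴ := by
      simp only [conjTranspose_mul, conjTranspose_conjTranspose, hP.1.eq, mul_assoc]
    rw [this, trace_conjTranspose, Complex.star_def, Complex.conj_re]
  rw [conjTranspose_sub, sub_mul, sub_mul, mul_sub, mul_sub, trace_sub, trace_sub, trace_sub] at h
  simp only [Complex.sub_re] at h
  linarith

variable [DecidableEq m]

/-- Polar decomposition `W = L |W|` with a contraction `L`. -/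
lemma exists_polar (W : Matrix m m ℂ) :
    ∃ L : Matrix m m ℂ, ‖L‖ ≤ 1 ∧ L * CFC.abs W = W ∧ Lᴴ * W = CFC.abs W := by
  set P := CFC.abs W
  have hPsa : IsSelfAdjoint P := (CFC.abs_nonneg W).isSelfAdjoint
  have hPP : P * P = Wᴴ * W := CFC.abs_mul_abs W
  have hPstar : Pᴴ = P := hPsa
  have hcont : ContinuousOn (fun x : ℝ => x⁻¹) (spectrum ℝ P) :=
    (Matrix.finite_real_spectrum (A := P)).continuousOn _
  -- Since 0⁻¹ = 0, `F` is the pseudo-inverse of |W|, `F * P` is its support projection and `W * F`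
  -- is the partial isometry sought.
  set F := cfc (fun x : ℝ => x⁻¹) P
  have hFstar : Fᴴ = F := IsSelfAdjoint.star_eq (cfc_predicate _ P)
  have hcomm : F * P = P * F := (Commute.cfc_real (Commute.refl P) _).eq
  have hPFP : F * P * P = P := by
    calc F * P * P = cfc (fun x : ℝ => x⁻¹) P * cfc (fun x : ℝ => x) P * cfc (fun x : ℝ => x) P := by
          rw [cfc_id' ℝ P hPsa]
      _ = cfc (fun x : ℝ => x⁻¹ * x * x) P := by
          rw [← cfc_mul .., ← cfc_mul _ _ P ((Matrix.finite_real_spectrum (A := P)).continuousOn _)]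
      _ = cfc (fun x : ℝ => x) P := by
          congr 1
          ext x
          rcases eq_or_ne x 0 with rfl | hx
          · simp
          · field_simp
      _ = P := cfc_id' ℝ P hPsa
  have hee : (F * P) * (F * P) = F * P := by
    rw [mul_assoc, ← mul_assoc P, ← hcomm, hPFP]
  have heH : (F * P)ᴴ = F * P := by rw [conjTranspose_mul, hFstar, hPstar, hcomm]
  have hLL : (W * F)ᴴ * (W * F) = F * P := by
    rw [conjTranspose_mul, hFstar, mul_assoc, ← mul_assoc Wᴴ, ← hPP, mul_assoc P, ← hcomm,
      ← mul_assoc, hee]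
  refine ⟨W * F, ?_, ?_, ?_⟩
  · have h1 : ‖W * F‖ * ‖W * F‖ = ‖F * P‖ := by
      rw [← hLL]; exact (CStarRing.norm_star_mul_self (x := W * F)).symm
    have h2 : ‖F * P‖ * ‖F * P‖ = ‖F * P‖ := by
      have := CStarRing.norm_star_mul_self (x := F * P)
      rw [star_eq_conjTranspose, heH, hee] at this
      exact this.symm
    have h3 := norm_nonneg (F * P)
    have h4 := norm_nonneg (W * F)
    have h5 : ‖F * P‖ ≤ 1 := by nlinarith
    nlinarith
  · have h0 : (W * F * P - W)ᴴ * (W * F * P - W) = 0 := by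
      have : W * F * P - W = W * (F * P - 1) := by rw [mul_sub, mul_one, mul_assoc]
      rw [this, conjTranspose_mul, mul_assoc, ← mul_assoc Wᴴ, ← hPP, mul_assoc P, mul_sub, mul_one,
        ← mul_assoc P, ← hcomm, hPFP, sub_self, mul_zero, mul_zero]
    have h1 : W * F * P - W = 0 := conjTranspose_mul_self_eq_zero.mp h0
    exact sub_eq_zero.mp h1
  · rw [conjTranspose_mul, hFstar, mul_assoc, ← hPP, ← mul_assoc, hPFP]

lemma traceNorm_of_nonneg {P : Matrix m m ℂ} (hP : 0 ≤ P) : traceNorm P = (trace P).re := by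
  rw [traceNorm, CFC.abs_of_nonneg P hP]

lemma re_trace_contraction_le {C P : Matrix m m ℂ} (hC : ‖C‖ ≤ 1) (hP : P.PosSemidef) :
    (trace (C * P * Cᴴ)).re ≤ (trace P).re := by
  have h1 : Cᴴ * C ≤ 1 := by
    have h := CStarAlgebra.star_mul_le_algebraMap_norm_sq (a := C)
    refine h.trans ?_
    have h2 : algebraMap ℝ (Matrix m m ℂ) (‖C‖ ^ 2) ≤ algebraMap ℝ (Matrix m m ℂ) 1 := by
      apply algebraMap_mono
      exact pow_le_one₀ (norm_nonneg _) hC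
    simpa using h2
  obtain ⟨B, rfl⟩ := CStarAlgebra.nonneg_iff_eq_star_mul_self.mp hP.nonneg
  have h2 := re_trace_nonneg ((Matrix.le_iff.mp h1).mul_mul_conjTranspose_same B)
  have h3 : trace (B * (1 - Cᴴ * C) * Bᴴ) = trace (star B * B) - trace (C * (star B * B) * Cᴴ) := by
    rw [mul_sub, sub_mul, trace_sub, mul_one, star_eq_conjTranspose, trace_mul_comm B]
    rw [trace_mul_comm _ Bᴴ, trace_mul_comm _ Cᴴ, ← mul_assoc, trace_mul_comm (Bᴴ * B),
      mul_assoc]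
  rw [h3, Complex.sub_re] at h2
  linarith

/-- With the next lemma: ‖W‖₁ is the maximum of Re Tr(KW) over contractions K, whence the triangle
inequality. -/
lemma re_trace_mul_le_traceNorm {K : Matrix m m ℂ} (hK : ‖K‖ ≤ 1) (W : Matrix m m ℂ) :
    (trace (K * W)).re ≤ traceNorm W := by
  obtain ⟨L, hL, hLW, -⟩ := exists_polar W
  have hP : (CFC.abs W).PosSemidef := Matrix.nonneg_iff_posSemidef.mp (CFC.abs_nonneg W)
  have hKL : ‖K * L‖ ≤ 1 := (norm_mul_le K L).trans (mul_le_one₀ hK (norm_nonneg _) hL)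
  have h := two_mul_re_trace_le (X := K * L) (Y := 1) hP
  have h1 := re_trace_contraction_le hKL hP
  rw [conjTranspose_one, one_mul, mul_one, mul_one] at h
  rw [mul_assoc K L, hLW] at h h1
  rw [traceNorm]
  linarith

lemma exists_re_trace_mul_eq_traceNorm (W : Matrix m m ℂ) :
    ∃ K : Matrix m m ℂ, ‖K‖ ≤ 1 ∧ (trace (K * W)).re = traceNorm W := by
  obtain ⟨L, hL, -, hLW⟩ := exists_polar W
  exact ⟨Lᴴ, (l2_opNorm_conjTranspose L).trans_le hL, by rw [hLW, traceNorm]⟩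

/-- The trace norm as a real seminorm. -/
noncomputable def traceSeminorm (m : Type*) [Fintype m] [DecidableEq m] :
    Seminorm ℝ (Matrix m m ℂ) :=
  Seminorm.of traceNorm
    (fun X Y => by
      obtain ⟨K, hK, h⟩ := exists_re_trace_mul_eq_traceNorm (X + Y)
      rw [← h, mul_add, trace_add, Complex.add_re]
      exact add_le_add (re_trace_mul_le_traceNorm hK X) (re_trace_mul_le_traceNorm hK Y))
    (fun c X => by
      rw [traceNorm, CFC.abs_smul, trace_smul, Complex.smul_re, smul_eq_mul, traceNorm])

lemma exists_traceSeminorm_le_mul_norm :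
    ∃ C : ℝ, ∀ W : Matrix m m ℂ, traceSeminorm m W ≤ C * ‖W‖ := by
  let T : Matrix m m ℂ →L[ℂ] ℂ := LinearMap.toContinuousLinearMap (traceLinearMap m ℂ ℂ)
  refine ⟨‖T‖, fun W => ?_⟩
  obtain ⟨K, hK, h⟩ := exists_re_trace_mul_eq_traceNorm W
  calc traceNorm W = (T (K * W)).re := h.symm
    _ ≤ ‖T (K * W)‖ := Complex.re_le_norm _
    _ ≤ ‖T‖ * ‖K * W‖ := T.le_opNorm _
    _ ≤ ‖T‖ * ‖W‖ := by
      gcongr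
      exact (norm_mul_le K W).trans (mul_le_of_le_one_left (norm_nonneg _) hK)

end TraceNorm

/-! ### One-sided differentiability of a seminorm along a curve. -/

section RightDerivative

open Topology

variable {E : Type*} [NormedAddCommGroup E] [NormedSpace ℝ E]

/-- Along the tangent line the seminorm is convex, so it has a right derivative; the bound by C‖x‖
makes the error of replacing the curve by its tangent o(τ - t). -/
lemma exists_hasDerivWithinAt_seminorm_comp {p : Seminorm ℝ E} {C : ℝ} (hp : ∀ x, p x ≤ C * ‖x‖)
    {X : ℝ → E} {Y : E} {t : ℝ} (hX : HasDerivWithinAt X Y (Set.Ici t) t) :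
    ∃ d : ℝ, HasDerivWithinAt (fun τ => p (X τ)) d (Set.Ici t) t := by
  let g : ℝ → ℝ := fun τ => p (X t + (τ - t) • Y)
  have hg : ConvexOn ℝ Set.univ g := by
    refine ⟨convex_univ, fun x _ y _ a b ha hb hab => ?_⟩
    have h : X t + ((a • x + b • y) - t) • Y
        = a • (X t + (x - t) • Y) + b • (X t + (y - t) • Y) := by
      obtain rfl : b = 1 - a := by linarith
      simp only [smul_eq_mul]
      module
    change p _ ≤ _
    rw [h]
    exact p.convexOn.2 trivial trivial ha hb hab
  obtain ⟨d, hd⟩ : ∃ d, HasDerivWithinAt g d (Set.Ici t) t :=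
    ⟨_, hasDerivWithinAt_Ioi_iff_Ici.mp
      (hg.hasDerivWithinAt_rightDeriv_of_mem_interior (x := t) (by simp))⟩
  refine ⟨d, ?_⟩
  rw [hasDerivWithinAt_iff_isLittleO] at hX hd ⊢
  have hdiff : (fun τ => p (X τ) - g τ) =o[𝓝[Set.Ici t] t] fun τ => τ - t := by
    refine Asymptotics.IsBigO.trans_isLittleO (.of_bound C (.of_forall fun τ => ?_)) hX
    refine (abs_sub_map_le_sub p _ _).trans ((hp _).trans_eq ?_)
    rw [sub_sub]
  refine (hdiff.add hd).congr_left fun τ => ?_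
  simp only [g, smul_eq_mul, sub_self, zero_smul, add_zero]
  ring

end RightDerivative

/-! ### Complete positivity and Kraus decompositions. -/

section CompletelyPositive

lemma exists_eq_star_mul_self {A : Type*} [NonUnitalCStarAlgebra A] [PartialOrder A]
    [StarOrderedRing A] {a : A} (h : 0 ≤ a) : ∃ b, a = star b * b :=
  CStarAlgebra.nonneg_iff_eq_star_mul_self.mp h

variable {n : Type*} [Fintype n]

lemma idTensor_eq_sum_kraus (k : Type*) [Fintype k] [DecidableEq k] {ι : Type*} [Fintype ι]
    {V : Module.End ℂ (Matrix n n ℂ)}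
    {K : ι → Matrix n n ℂ} (h : ∀ ρ, V ρ = ∑ c, K c * ρ * (K c)ᴴ) (W : Matrix (k × n) (k × n) ℂ) :
    idTensor k V W
      = ∑ c, kroneckerMap (· * ·) (1 : Matrix k k ℂ) (K c) * W
          * (kroneckerMap (· * ·) (1 : Matrix k k ℂ) (K c))ᴴ := by
  ext ⟨i, a⟩ ⟨j, b⟩
  simp only [idTensor, LinearMap.coe_mk, AddHom.coe_mk, of_apply, h, Matrix.sum_apply, mul_apply,
    conjTranspose_apply, kroneckerMap_apply, Fintype.sum_prod_type, one_apply, ite_mul, one_mul,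
    zero_mul, star_zero, mul_ite, mul_zero, Finset.sum_ite_irrel, Finset.sum_const_zero,
    Finset.sum_ite_eq, Finset.mem_univ, if_true, apply_ite star]

variable [DecidableEq n]

/-- A linear map whose Choi matrix factors through `ι` has a Kraus decomposition indexed by `ι`. -/
lemma eq_sum_kraus_of_choi {ι : Type*} [Fintype ι] {V : Module.End ℂ (Matrix n n ℂ)}
    (K : ι → Matrix n n ℂ)
    (h : ∀ i j a b, V (single i j 1) a b = ∑ c, K c a i * star (K c b j)) (ρ : Matrix n n ℂ) :
    V ρ = ∑ c, K c * ρ * (K c)ᴴ := by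
  conv_lhs => rw [matrix_eq_sum_single ρ]
  ext a b
  simp only [map_sum, Matrix.sum_apply, mul_apply, conjTranspose_apply, Finset.sum_mul]
  have h1 : ∀ i j, V (single i j (ρ i j)) a b = ∑ c, K c a i * ρ i j * star (K c b j) := by
    intro i j
    have h2 : single i j (ρ i j) = ρ i j • single i j (1 : ℂ) := by simp [smul_single]
    rw [h2, map_smul, Matrix.smul_apply, h, smul_eq_mul, Finset.mul_sum]
    exact Finset.sum_congr rfl fun c _ => by ring
  simp only [h1]
  rw [Finset.sum_comm]
  simp_rw [Finset.sum_comm (s := Finset.univ (α := n)) (t := Finset.univ (α := ι))]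

lemma isCompletelyPositive_of_kraus {ι : Type*} [Fintype ι] {V : Module.End ℂ (Matrix n n ℂ)}
    {K : ι → Matrix n n ℂ} (h : ∀ ρ, V ρ = ∑ c, K c * ρ * (K c)ᴴ) : IsCompletelyPositive V := by
  refine ⟨⟨V, fun k M hM => ?_⟩, rfl⟩
  -- Entrywise application of V is a sum of conjugations by block diagonal matrices.
  have h1 : M.map V = ∑ c, star (CStarMatrix.ofMatrix (diagonal fun _ : Fin k => (K c)ᴴ)) * M
      * CStarMatrix.ofMatrix (diagonal fun _ : Fin k => (K c)ᴴ) := by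
    ext i j : 2
    have h2 : M.map V i j = ∑ c, K c * M i j * (K c)ᴴ := h _
    have h3 : ∀ f : ι → CStarMatrix (Fin k) (Fin k) (Matrix n n ℂ),
        (∑ c, f c) i j = ∑ c, f c i j := fun f =>
      map_sum (AddMonoidHom.mk' (fun X : CStarMatrix (Fin k) (Fin k) (Matrix n n ℂ) => X i j)
        fun _ _ => rfl) f Finset.univ
    refine congrFun (congrFun ((h2.trans ?_).trans (h3 _).symm) _) _
    refine Finset.sum_congr rfl fun c _ => ?_
    simp [CStarMatrix.mul_apply, CStarMatrix.star_apply, diagonal_apply, apply_ite star,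
      star_eq_conjTranspose, ite_mul, mul_ite]
  rw [h1]
  exact Finset.sum_nonneg fun c _ => star_left_conjugate_nonneg hM _

lemma IsCompletelyPositive.exists_kraus {V : Module.End ℂ (Matrix n n ℂ)}
    (hV : IsCompletelyPositive V) :
    ∃ K : n × n → Matrix n n ℂ, ∀ ρ, V ρ = ∑ c, K c * ρ * (K c)ᴴ := by
  obtain ⟨Ψ, rfl⟩ := hV
  let M : CStarMatrix n n (Matrix n n ℂ) := CStarMatrix.ofMatrix (of fun i j => single i j 1)
  have hM : 0 ≤ M := by
    rcases isEmpty_or_nonempty n with hn | ⟨⟨i₀⟩⟩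
    · exact (Subsingleton.elim 0 M).le
    -- A single nonzero row suffices, because E_ij = (E_{i₀i})† E_{i₀j}.
    · let N : CStarMatrix n n (Matrix n n ℂ) :=
        CStarMatrix.ofMatrix (of fun l j => if l = i₀ then single i₀ j 1 else 0)
      have hN : M = star N * N := by
        ext i j : 2
        simp [M, N, CStarMatrix.mul_apply, CStarMatrix.star_apply, apply_ite star,
          star_eq_conjTranspose]
      rw [hN]
      exact star_mul_self_nonneg N
  obtain ⟨N, hN⟩ := exists_eq_star_mul_self (Ψ.map_cstarMatrix_nonneg M hM)
  refine ⟨fun c => of fun a i => star (N c.1 i c.2 a), eq_sum_kraus_of_choi _ fun i j a b => ?_⟩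
  have h1 : Ψ (single i j 1) = ∑ l, (N l i)ᴴ * N l j := by
    have := congrArg (fun X : CStarMatrix n n (Matrix n n ℂ) => X i j) hN
    simpa [CStarMatrix.mul_apply, CStarMatrix.star_apply, M, star_eq_conjTranspose] using this
  have h2 : Ψ.toLinearMap (single i j 1) = ∑ l, (N l i)ᴴ * N l j := h1
  rw [h2]
  simp [Matrix.sum_apply, mul_apply, Fintype.sum_prod_type]

end CompletelyPositive

/-! ### Choi matrices, trace norm contraction and the diamond norm. -/

section Propagator

variable {n : Type*}

lemma idTensor_apply (k : Type*) (V : Module.End ℂ (Matrix n n ℂ)) (W : Matrix (k × n) (k × n) ℂ)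
    (i j : k) (a b : n) :
    idTensor k V W (i, a) (j, b) = V (of fun a b => W (i, a) (j, b)) a b := rfl

lemma idTensor_conjTranspose (k : Type*) {V : Module.End ℂ (Matrix n n ℂ)}
    (hV : ∀ ρ, V ρᴴ = (V ρ)ᴴ) (W : Matrix (k × n) (k × n) ℂ) :
    idTensor k V Wᴴ = (idTensor k V W)ᴴ := by
  ext ⟨i, a⟩ ⟨j, b⟩
  exact congrFun (congrFun (hV (of fun a b => W (j, a) (i, b))) a) b

lemma idTensor_real_smul (k : Type*) (V : Module.End ℂ (Matrix n n ℂ)) (c : ℝ)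
    (W : Matrix (k × n) (k × n) ℂ) : idTensor k V (c • W) = c • idTensor k V W :=
  (idTensor k V).map_smul_of_tower c W

/-- The embedding of `B(H)` as the `(i, j)` block of `B(ℂᵏ ⊗ H)`. -/
def blockSingle {k : Type*} [DecidableEq k] (i j : k) :
    Matrix n n ℂ →ₗ[ℝ] Matrix (k × n) (k × n) ℂ where
  toFun X := of fun p q => if p.1 = i ∧ q.1 = j then X p.2 q.2 else 0
  map_add' X Y := by
    ext p q
    simp only [of_apply, Matrix.add_apply]
    split_ifs <;> simp
  map_smul' c X := by ext p q; simp

lemma idTensor_eq_sum_blockSingle {k : Type*} [Fintype k] [DecidableEq k]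
    (V : Module.End ℂ (Matrix n n ℂ)) (W : Matrix (k × n) (k × n) ℂ) :
    idTensor k V W
      = ∑ c : k × k, blockSingle c.1 c.2 (V (of fun a b => W (c.1, a) (c.2, b))) := by
  ext ⟨i, a⟩ ⟨j, b⟩
  rw [Matrix.sum_apply, Finset.sum_eq_single (i, j)]
  · simp [blockSingle, idTensor_apply]
  · rintro ⟨i', j'⟩ - h
    have : ¬(i = i' ∧ j = j') := fun h' => h (by rw [h'.1, h'.2])
    simp [blockSingle, this]
  · simp

/-- The projection `∑ᵢⱼ |i⟩⟨j| ⊗ |i⟩⟨j|` onto the (unnormalized) maximally entangled vector. -/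
def maxEntangled (n : Type*) [DecidableEq n] : Matrix (n × n) (n × n) ℂ :=
  vecMulVec (fun p => if p.1 = p.2 then 1 else 0) (fun p => if p.1 = p.2 then 1 else 0)

lemma idTensor_maxEntangled_apply [DecidableEq n] (V : Module.End ℂ (Matrix n n ℂ)) (i j a b : n) :
    idTensor n V (maxEntangled n) (i, a) (j, b) = V (single i j 1) a b := by
  have h : (of fun a b => maxEntangled n (i, a) (j, b)) = single i j 1 := by
    ext a b
    simp only [maxEntangled, vecMulVec_apply, single_apply, of_apply]
    split_ifs <;> simp_all
  rw [idTensor_apply, h]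

variable [Fintype n]

lemma trace_idTensor (k : Type*) [Fintype k] {V : Module.End ℂ (Matrix n n ℂ)}
    (hV : ∀ ρ, trace (V ρ) = trace ρ) (W : Matrix (k × n) (k × n) ℂ) :
    trace (idTensor k V W) = trace W := by
  simp only [trace, diag_apply, Fintype.sum_prod_type, idTensor_apply]
  exact Finset.sum_congr rfl fun i _ => hV (of fun a b => W (i, a) (i, b))

variable [DecidableEq n]

lemma posSemidef_maxEntangled : (maxEntangled n).PosSemidef := by
  have h : star (fun p : n × n => if p.1 = p.2 then (1 : ℂ) else 0)
      = fun p => if p.1 = p.2 then 1 else 0 := by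
    ext p
    simp [apply_ite star]
  have h1 := posSemidef_vecMulVec_self_star (fun p : n × n => if p.1 = p.2 then (1 : ℂ) else 0)
  rwa [h] at h1

lemma IsCompletelyPositive.map_conjTranspose {V : Module.End ℂ (Matrix n n ℂ)}
    (hV : IsCompletelyPositive V) (ρ : Matrix n n ℂ) : V ρᴴ = (V ρ)ᴴ := by
  obtain ⟨K, h⟩ := hV.exists_kraus
  simp only [h, conjTranspose_sum, conjTranspose_mul, conjTranspose_conjTranspose, mul_assoc]

/-- Completely positive trace preserving maps contract the trace norm, also on operators that are
not Hermitian. -/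
lemma IsCompletelyPositive.traceNorm_idTensor_le {V : Module.End ℂ (Matrix n n ℂ)}
    (hV : IsCompletelyPositive V) (htr : ∀ ρ, trace (V ρ) = trace ρ)
    (k : Type*) [Fintype k] [DecidableEq k] (W : Matrix (k × n) (k × n) ℂ) :
    traceNorm (idTensor k V W) ≤ traceNorm W := by
  obtain ⟨K, h⟩ := hV.exists_kraus
  set A : n × n → Matrix (k × n) (k × n) ℂ :=
    fun c => kroneckerMap (· * ·) (1 : Matrix k k ℂ) (K c)
  have hk : ∀ X, idTensor k V X = ∑ c, A c * X * (A c)ᴴ := idTensor_eq_sum_kraus k h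
  obtain ⟨C, hC, hCW⟩ := exists_re_trace_mul_eq_traceNorm (idTensor k V W)
  obtain ⟨L, hL, hLW, -⟩ := exists_polar W
  set P := CFC.abs W
  have hP : P.PosSemidef := Matrix.nonneg_iff_posSemidef.mp (CFC.abs_nonneg W)
  have hQ : (L * P * Lᴴ).PosSemidef := hP.mul_mul_conjTranspose_same L
  -- With W = LP, Cauchy–Schwarz splits each Kraus term into two positive ones. Summed over c, these
  -- have traces Tr(LPL†) and Tr P by trace preservation, both at most ‖W‖₁.
  have key : ∀ c, 2 * (trace (C * (A c * W * (A c)ᴴ))).re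
      ≤ (trace (A c * (L * P * Lᴴ) * (A c)ᴴ)).re + (trace (A c * P * (A c)ᴴ)).re := fun c => by
    have h1 := two_mul_re_trace_le (X := C * A c * L) (Y := A c) hP
    have h2 := re_trace_contraction_le hC (hQ.mul_mul_conjTranspose_same (A c))
    have e1 : C * A c * L * P * (A c)ᴴ = C * (A c * W * (A c)ᴴ) := by
      rw [← hLW]; simp only [mul_assoc]
    have e2 : C * A c * L * P * (C * A c * L)ᴴ = C * (A c * (L * P * Lᴴ) * (A c)ᴴ) * Cᴴ := by
      simp only [conjTranspose_mul, mul_assoc]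
    rw [e1, e2] at h1
    linarith
  have h1 := Finset.sum_le_sum fun c (_ : c ∈ Finset.univ) => key c
  rw [← Finset.mul_sum, Finset.sum_add_distrib, ← Complex.re_sum, ← Complex.re_sum,
    ← Complex.re_sum, ← trace_sum, ← trace_sum, ← trace_sum, ← Finset.mul_sum, ← hk, ← hk, ← hk,
    hCW, trace_idTensor k htr, trace_idTensor k htr] at h1
  have h2 := re_trace_contraction_le hL hP
  change _ ≤ (trace P).re
  linarith

/-- |X| - X is twice the negative part of X; being positive with trace at most 0, it vanishes. -/
lemma posSemidef_of_traceNorm_le_re_trace {m : Type*} [Fintype m] [DecidableEq m]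
    {X : Matrix m m ℂ} (hX : X.IsHermitian) (h : traceNorm X ≤ (trace X).re) : X.PosSemidef := by
  have h1 : (CFC.abs X - X).PosSemidef := by
    rw [CFC.abs_sub_self X hX]
    exact Matrix.nonneg_iff_posSemidef.mp (smul_nonneg zero_le_two (CFC.negPart_nonneg X))
  have h2 : (trace (CFC.abs X - X)).re = 0 := by
    refine le_antisymm ?_ (re_trace_nonneg h1)
    rw [trace_sub, Complex.sub_re]
    exact sub_nonpos.mpr h
  have h3 : trace (CFC.abs X - X) = 0 := by
    refine Complex.ext h2 (Complex.le_def.mp h1.trace_nonneg).2.symm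
  have h4 := sub_eq_zero.mp (h1.trace_eq_zero_iff.mp h3)
  rw [← h4]
  exact Matrix.nonneg_iff_posSemidef.mp (CFC.abs_nonneg X)

/-- Choi's criterion. -/
lemma isCompletelyPositive_of_posSemidef_choi {V : Module.End ℂ (Matrix n n ℂ)}
    (h : (idTensor n V (maxEntangled n)).PosSemidef) : IsCompletelyPositive V := by
  obtain ⟨B, hB⟩ := CStarAlgebra.nonneg_iff_eq_star_mul_self.mp h.nonneg
  refine isCompletelyPositive_of_kraus (K := fun m : n × n => of fun a i => star (B m (i, a)))
    (eq_sum_kraus_of_choi _ fun i j a b => ?_)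
  rw [← idTensor_maxEntangled_apply, hB]
  simp [mul_apply]

lemma isCompletelyPositive_of_traceNorm_le {V : Module.End ℂ (Matrix n n ℂ)}
    (hstar : ∀ ρ, V ρᴴ = (V ρ)ᴴ) (htr : ∀ ρ, trace (V ρ) = trace ρ)
    (h : traceNorm (idTensor n V (maxEntangled n)) ≤ traceNorm (maxEntangled n)) :
    IsCompletelyPositive V := by
  refine isCompletelyPositive_of_posSemidef_choi (posSemidef_of_traceNorm_le_re_trace ?_ ?_)
  · rw [Matrix.IsHermitian, ← idTensor_conjTranspose n hstar, posSemidef_maxEntangled.1.eq]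
  · rwa [trace_idTensor n htr, ← traceNorm_of_nonneg posSemidef_maxEntangled.nonneg]

lemma traceNorm_smul (c : ℝ) {m : Type*} [Fintype m] [DecidableEq m] (W : Matrix m m ℂ) :
    traceNorm (c • W) = |c| * traceNorm W :=
  map_smul_eq_mul (traceSeminorm m) c W

lemma traceNorm_maxEntangled_pos [Nonempty n] : 0 < traceNorm (maxEntangled n) := by
  have h : trace (maxEntangled n) = Fintype.card n := by
    simp [maxEntangled, trace, vecMulVec_apply, Fintype.sum_prod_type]
  rw [traceNorm_of_nonneg posSemidef_maxEntangled.nonneg, h]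
  simpa using Fintype.card_pos (α := n)

lemma traceNorm_idTensor_le_of_diamondNorm_eq_one {V : Module.End ℂ (Matrix n n ℂ)}
    (h : diamondNorm V = 1) {W : Matrix (n × n) (n × n) ℂ} (hW : 0 < traceNorm W) :
    traceNorm (idTensor n V W) ≤ traceNorm W := by
  have hbdd : BddAbove {x : ℝ | ∃ W : Matrix (n × n) (n × n) ℂ,
      traceNorm W = 1 ∧ x = traceNorm (idTensor n V W)} := by
    -- An unbounded set has `sSup` equal to 0, so the value 1 forces boundedness.
    by_contra hb
    rw [diamondNorm, Real.sSup_of_not_bddAbove hb] at h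
    exact zero_ne_one h
  have hc : 0 < (traceNorm W)⁻¹ := inv_pos.mpr hW
  have h1 := le_csSup hbdd ⟨(traceNorm W)⁻¹ • W,
    by rw [traceNorm_smul, abs_of_pos hc, inv_mul_cancel₀ hW.ne'], rfl⟩
  change _ ≤ diamondNorm V at h1
  rw [h, idTensor_real_smul, traceNorm_smul, abs_of_pos hc, inv_mul_le_iff₀ hW, mul_one] at h1
  exact h1

lemma IsCompletelyPositive.diamondNorm_eq_one [Nonempty n] {V : Module.End ℂ (Matrix n n ℂ)}
    (hV : IsCompletelyPositive V) (htr : ∀ ρ, trace (V ρ) = trace ρ) : diamondNorm V = 1 := by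
  refine IsGreatest.csSup_eq ⟨?_, ?_⟩
  · have hpos := traceNorm_maxEntangled_pos (n := n)
    have hc : 0 < (traceNorm (maxEntangled n))⁻¹ := inv_pos.mpr hpos
    set W := (traceNorm (maxEntangled n))⁻¹ • maxEntangled n with hWdef
    have hW : traceNorm W = 1 := by
      rw [hWdef, traceNorm_smul, abs_of_pos hc, inv_mul_cancel₀ hpos.ne']
    refine ⟨W, hW, le_antisymm ?_ ((hV.traceNorm_idTensor_le htr n W).trans_eq hW)⟩
    have h0 : 0 ≤ W := smul_nonneg hc.le posSemidef_maxEntangled.nonneg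
    -- K = 1 bounds the trace norm below by the trace, which V preserves; so the supremum is
    -- attained at `W`.
    have h1 := re_trace_mul_le_traceNorm (K := 1) (W := idTensor n V W) norm_one.le
    rwa [one_mul, trace_idTensor n htr, ← traceNorm_of_nonneg h0, hW] at h1
  · rintro x ⟨W, hW, rfl⟩
    exact (hV.traceNorm_idTensor_le htr n W).trans_eq hW

end Propagator

/-! ### Propagators of a dynamical map and monotonicity in time. -/

section DynamicalMap

variable {n : Type*} {Λ : ℝ → Module.End ℂ (Matrix n n ℂ)}

lemma propagator_comp {s : ℝ} (hs : IsUnit (Λ s)) (t : ℝ) : propagator Λ t s ∘ₗ Λ s = Λ t := by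
  rw [propagator, LinearMap.comp_assoc]
  change Λ t ∘ₗ (Ring.inverse (Λ s) * Λ s) = Λ t
  rw [Ring.inverse_mul_cancel _ hs]
  rfl

lemma eq_propagator {s t : ℝ} (hs : IsUnit (Λ s)) {V : Module.End ℂ (Matrix n n ℂ)}
    (h : Λ t = V ∘ₗ Λ s) : propagator Λ t s = V := by
  rw [propagator, h, LinearMap.comp_assoc]
  change V ∘ₗ (Λ s * Ring.inverse (Λ s)) = V
  rw [Ring.mul_inverse_cancel _ hs]
  rfl

lemma exists_map_eq {s : ℝ} (hs : IsUnit (Λ s)) (ρ : Matrix n n ℂ) : ∃ σ, Λ s σ = ρ :=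
  ((Module.End.isUnit_iff _).mp hs).2 ρ

variable [Fintype n] [DecidableEq n]

lemma trace_propagator (hΛ : IsDynamicalMap Λ) {s t : ℝ} (hs : 0 ≤ s) (hst : s ≤ t)
    (hinv : IsUnit (Λ s)) (ρ : Matrix n n ℂ) : trace (propagator Λ t s ρ) = trace ρ := by
  obtain ⟨σ, rfl⟩ := exists_map_eq hinv ρ
  rw [← LinearMap.comp_apply, propagator_comp hinv, hΛ.tracePreserving t (hs.trans hst),
    hΛ.tracePreserving s hs]

lemma propagator_conjTranspose (hΛ : IsDynamicalMap Λ) {s t : ℝ} (hs : 0 ≤ s) (hst : s ≤ t)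
    (hinv : IsUnit (Λ s)) (ρ : Matrix n n ℂ) :
    propagator Λ t s ρᴴ = (propagator Λ t s ρ)ᴴ := by
  obtain ⟨σ, rfl⟩ := exists_map_eq hinv ρ
  rw [← (hΛ.completelyPositive s hs).map_conjTranspose, ← LinearMap.comp_apply,
    ← LinearMap.comp_apply, propagator_comp hinv,
    (hΛ.completelyPositive t (hs.trans hst)).map_conjTranspose]

lemma isDivisible_of_traceNorm_le (hΛ : IsDynamicalMap Λ) (hinv : ∀ t : ℝ, 0 ≤ t → IsUnit (Λ t))
    (h : ∀ s t : ℝ, 0 ≤ s → s ≤ t →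
      traceNorm (idTensor n (propagator Λ t s) (maxEntangled n)) ≤ traceNorm (maxEntangled n)) :
    IsDivisible Λ := fun s t hs hst =>
  ⟨propagator Λ t s, isCompletelyPositive_of_traceNorm_le
    (propagator_conjTranspose hΛ hs hst (hinv s hs)) (trace_propagator hΛ hs hst (hinv s hs))
    (h s t hs hst), (propagator_comp (hinv s hs) t).symm⟩

lemma IsDivisible.isCompletelyPositive_propagator (hdiv : IsDivisible Λ) {s t : ℝ} (hs : 0 ≤ s)
    (hst : s ≤ t) (hinv : IsUnit (Λ s)) : IsCompletelyPositive (propagator Λ t s) := by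
  obtain ⟨V, hV, h⟩ := hdiv s t hs hst
  rwa [eq_propagator hinv h]

lemma differentiableOn_idTensor (hdiff : ∀ ρ : Matrix n n ℂ,
    DifferentiableOn ℝ (fun t => Λ t ρ) (Set.Ici 0)) {k : Type*} [Fintype k] [DecidableEq k]
    (W : Matrix (k × n) (k × n) ℂ) :
    DifferentiableOn ℝ (fun t => idTensor k (Λ t) W) (Set.Ici 0) := by
  simp_rw [idTensor_eq_sum_blockSingle]
  refine DifferentiableOn.fun_sum fun c _ => ?_
  exact (LinearMap.toContinuousLinearMap
    (blockSingle (n := n) c.1 c.2)).differentiable.comp_differentiableOn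
    (hdiff _)

lemma exists_hasDerivWithinAt_traceNorm (hdiff : ∀ ρ : Matrix n n ℂ,
    DifferentiableOn ℝ (fun t => Λ t ρ) (Set.Ici 0)) {k : Type*} [Fintype k] [DecidableEq k]
    (W : Matrix (k × n) (k × n) ℂ) {t : ℝ} (ht : 0 ≤ t) :
    ∃ d : ℝ, HasDerivWithinAt (fun τ => traceNorm (idTensor k (Λ τ) W)) d (Set.Ici t) t := by
  obtain ⟨C, hC⟩ := exists_traceSeminorm_le_mul_norm (m := k × n)
  exact exists_hasDerivWithinAt_seminorm_comp hC
    ((differentiableOn_idTensor hdiff W t ht).hasDerivWithinAt.mono (Set.Ici_subset_Ici.mpr ht))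

lemma continuousOn_traceNorm (hdiff : ∀ ρ : Matrix n n ℂ,
    DifferentiableOn ℝ (fun t => Λ t ρ) (Set.Ici 0)) {k : Type*} [Fintype k] [DecidableEq k]
    (W : Matrix (k × n) (k × n) ℂ) :
    ContinuousOn (fun τ => traceNorm (idTensor k (Λ τ) W)) (Set.Ici 0) :=
  ((traceSeminorm (k × n)).convexOn.continuousOn isOpen_univ).comp
    (differentiableOn_idTensor hdiff W).continuousOn (Set.mapsTo_univ _ _)

lemma IsDivisible.antitoneOn_traceNorm (hdiv : IsDivisible Λ) (hΛ : IsDynamicalMap Λ)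
    (hinv : ∀ t : ℝ, 0 ≤ t → IsUnit (Λ t)) {k : Type*} [Fintype k] [DecidableEq k]
    (W : Matrix (k × n) (k × n) ℂ) :
    AntitoneOn (fun τ => traceNorm (idTensor k (Λ τ) W)) (Set.Ici 0) := by
  intro s hs t ht hst
  have h := (hdiv.isCompletelyPositive_propagator hs hst (hinv s hs)).traceNorm_idTensor_le
    (trace_propagator hΛ hs hst (hinv s hs)) k (idTensor k (Λ s) W)
  have h1 : idTensor k (propagator Λ t s) (idTensor k (Λ s) W) = idTensor k (Λ t) W := by
    conv_rhs => rw [← propagator_comp (hinv s hs) t]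
    rfl
  rwa [h1] at h

/-- The inverse of Λ_s need not be positive, but it commutes with the adjoint because Λ_s does. -/
lemma exists_isHermitian_idTensor_eq (hΛ : IsDynamicalMap Λ) {s : ℝ} (hs : 0 ≤ s)
    (hinv : IsUnit (Λ s)) {k : Type*} {X : Matrix (k × n) (k × n) ℂ} (hX : X.IsHermitian) :
    ∃ W : Matrix (k × n) (k × n) ℂ, W.IsHermitian ∧ idTensor k (Λ s) W = X := by
  have h1 : ∀ Y : Matrix (k × n) (k × n) ℂ, idTensor k (Λ s * Ring.inverse (Λ s)) Y = Y :=
    fun Y => by rw [Ring.mul_inverse_cancel _ hinv]; rfl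
  have h2 : ∀ Y : Matrix (k × n) (k × n) ℂ,
      idTensor k (Ring.inverse (Λ s)) (idTensor k (Λ s) Y) = Y := fun Y => by
    change idTensor k (Ring.inverse (Λ s) * Λ s) Y = Y
    rw [Ring.inverse_mul_cancel _ hinv]; rfl
  have h3 : idTensor k (Λ s) (idTensor k (Ring.inverse (Λ s)) X) = X := h1 X
  refine ⟨idTensor k (Ring.inverse (Λ s)) X, ?_, h3⟩
  rw [Matrix.IsHermitian, ← h2 (idTensor k (Ring.inverse (Λ s)) X)ᴴ,
    idTensor_conjTranspose k (hΛ.completelyPositive s hs).map_conjTranspose, h3, hX.eq]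

lemma le_of_rightDeriv_nonpos {f : ℝ → ℝ} (hf : ContinuousOn f (Set.Ici 0))
    (h : ∀ t : ℝ, 0 ≤ t → ∃ d : ℝ, d ≤ 0 ∧ HasDerivWithinAt f d (Set.Ici t) t) {s t : ℝ}
    (hs : 0 ≤ s) (hst : s ≤ t) : f t ≤ f s := by
  choose! d hd0 hd using h
  exact image_le_of_deriv_right_le_deriv_boundary (B := fun _ => f s) (B' := fun _ => 0)
    (hf.mono fun x hx => hs.trans hx.1) (fun x hx => hd x (hs.trans hx.1)) le_rfl
    continuousOn_const (fun x _ => hasDerivWithinAt_const x _ _)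
    (fun x hx => hd0 x (hs.trans hx.1)) ⟨hst, le_rfl⟩

end DynamicalMap

end QuantumDynamics

theorem theorem3 {n : Type*} [Fintype n] [DecidableEq n] [Nonempty n]
    (Λ : ℝ → Module.End ℂ (Matrix n n ℂ))
    (hΛ : QuantumDynamics.IsDynamicalMap Λ)
    (hdiff : ∀ ρ : Matrix n n ℂ, DifferentiableOn ℝ (fun t => Λ t ρ) (Set.Ici 0))
    (hinv : ∀ t : ℝ, 0 ≤ t → IsUnit (Λ t)) :
    List.TFAE [
      QuantumDynamics.IsDivisible Λ,
      ∀ s t : ℝ, 0 ≤ s → s ≤ t →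
        QuantumDynamics.diamondNorm (QuantumDynamics.propagator Λ t s) = 1,
      ∀ W : Matrix (n × n) (n × n) ℂ, W.IsHermitian → ∀ t : ℝ, 0 ≤ t →
        ∃ d : ℝ, d ≤ 0 ∧
          HasDerivWithinAt
            (fun τ => QuantumDynamics.traceNorm (QuantumDynamics.idTensor n (Λ τ) W))
            d (Set.Ici t) t] := by
  open QuantumDynamics in
  tfae_have 1 → 2 := fun hdiv s t hs hst =>
    (hdiv.isCompletelyPositive_propagator hs hst (hinv s hs)).diamondNorm_eq_one
      (trace_propagator hΛ hs hst (hinv s hs))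
  tfae_have 2 → 1 := fun h => isDivisible_of_traceNorm_le hΛ hinv fun s t hs hst =>
    traceNorm_idTensor_le_of_diamondNorm_eq_one (h s t hs hst) traceNorm_maxEntangled_pos
  tfae_have 1 → 3 := fun hdiv W _ t ht => by
    obtain ⟨d, hd⟩ := exists_hasDerivWithinAt_traceNorm hdiff W ht
    refine ⟨d, ?_, hd⟩
    rw [← hd.derivWithin (uniqueDiffWithinAt_Ici t)]
    exact ((hdiv.antitoneOn_traceNorm hΛ hinv W).mono (Set.Ici_subset_Ici.mpr ht)).derivWithin_nonpos
  tfae_have 3 → 1 := fun h => isDivisible_of_traceNorm_le hΛ hinv fun s t hs hst => by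
    -- W is chosen so that its evolution is `maxEntangled n` at time s, hence the Choi matrix of
    -- V_{t,s} at time t.
    obtain ⟨W, hW, hWs⟩ :=
      exists_isHermitian_idTensor_eq hΛ hs (hinv s hs) (posSemidef_maxEntangled (n := n)).1
    have h1 := le_of_rightDeriv_nonpos (continuousOn_traceNorm hdiff W) (h W hW) hs hst
    have h2 : idTensor n (propagator Λ t s) (idTensor n (Λ s) W) = idTensor n (Λ t) W := by
      conv_rhs => rw [← propagator_comp (hinv s hs) t]
      rfl
    rwa [← h2, hWs] at h1
  tfae_finish
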